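/- Let $n, s, d$ be non-negative integers with $s\le n+2$, let $m_1,\dots,m_s$ be non-negative integers, and let $p_1,\dots,p_s$ be general points of complex projective space $\mathbb P^n$; it is enough that they are in linearly general position, i.e. that any at most $n+1$ of them are linearly independent. Let $\mathcal L=\mathcal L_{n,d}(m_1,\dots,m_s)$ be the linear system of hypersurfaces of degree $d$ in $\mathbb P^n$ having multiplicity at least $m_i$ at $p_i$ for $i=1,\dots,s$, and assume that $\mathcal L$ is non-empty. Let $0\le r\le \min(n,s)-1$, let $I\subseteq\{1,\dots,s\}$ be any subset with $|I|=r+1$, and let $L_I$ be the $r$-dimensional linear subspace of $\mathbb P^n$ spanned by the points $p_i$, $i\in I$. Then $L_I$ is contained in the base locus of $\mathcal L$ with multiplicity exactly $$k_I=\max\Big(\sum_{i\in I}m_i-rd,\;0\Big),$$ that is, the minimum over all hypersurfaces $D\in\mathcal L$ of the multiplicity of $D$ along $L_I$ (the multiplicity of $D$ at a general point of $L_I$, equivalently the least multiplicity of $D$ at a point of $L_I$) equals $k_I$. (Multiplicity $0$ means that $L_I$ is not contained in the base locus.) -/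

import Mathlib

open scoped LinearAlgebra.Projectivization

namespace LinSys

noncomputable section

/-- Complex projective space `ℙⁿ`, with homogeneous coordinates `x₀, …, xₙ`. -/
abbrev PSpace (n : ℕ) : Type := ℙ ℂ (Fin (n + 1) → ℂ)

/-- Order of vanishing of a polynomial at a point `v` of affine space: the lowest total degree of
a monomial occurring in the Taylor expansion `f(v + y)`; it is `⊤` exactly for `f = 0`. -/
def orderAt {n : ℕ} (f : MvPolynomial (Fin (n + 1)) ℂ) (v : Fin (n + 1) → ℂ) : ℕ∞ :=
  MvPowerSeries.order
    ((MvPolynomial.aeval (fun j => MvPolynomial.X j + MvPolynomial.C (v j)) f :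
      MvPolynomial (Fin (n + 1)) ℂ) : MvPowerSeries (Fin (n + 1)) ℂ)

/-- Multiplicity at `x ∈ ℙⁿ` of the hypersurface with (homogeneous) equation `f`. The cone over
the hypersurface is, near a point over `x`, the product of the hypersurface and a line, so this is
the order of vanishing of `f` at any vector representing `x`. -/
def multAt {n : ℕ} (f : MvPolynomial (Fin (n + 1)) ℂ) (x : PSpace n) : ℕ∞ :=
  orderAt f x.rep

/-- Multiplicity along a linear subspace `L` of the hypersurface with equation `f`: its
multiplicity at a general point of `L`, which is the least multiplicity at a point of `L`. -/
def multAlong {n : ℕ} (f : MvPolynomial (Fin (n + 1)) ℂ)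
    (L : Projectivization.Subspace ℂ (Fin (n + 1) → ℂ)) : ℕ∞ :=
  ⨅ x ∈ L, multAt f x

/-- The linear system `L_{n,d}(m₁, …, m_s)` of hypersurfaces of degree `d` having multiplicity at
least `m i` at `p i`; a hypersurface is given by a nonzero form (unique up to a scalar). -/
def linearSystem {n s : ℕ} (d : ℕ) (p : Fin s → PSpace n) (m : Fin s → ℕ) :
    Set (MvPolynomial (Fin (n + 1)) ℂ) :=
  {f | f ≠ 0 ∧ f.IsHomogeneous d ∧ ∀ i, (m i : ℕ∞) ≤ multAt f (p i)}

/-- Multiplicity with which the linear subspace `L` is contained in the base locus of the linear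
system `𝓛`: the least multiplicity along `L` of a member of `𝓛` (equivalently, the multiplicity
along `L` of a general member). It is `0` iff `L` is not contained in the base locus. -/
def baseMult {n : ℕ} (𝓛 : Set (MvPolynomial (Fin (n + 1)) ℂ))
    (L : Projectivization.Subspace ℂ (Fin (n + 1) → ℂ)) : ℕ∞ :=
  ⨅ f ∈ 𝓛, multAlong f L

/-- Linearly general position: any at most `n + 1` of the points are projectively independent. -/
def GeneralPosition {n s : ℕ} (p : Fin s → PSpace n) : Prop :=
  ∀ I : Finset (Fin s), I.card ≤ n + 1 →
    Projectivization.Independent (fun i : I => p i)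

/-- The linear cycle `L_I` spanned by the points `p i`, `i ∈ I`. -/
def linearCycle {n s : ℕ} (p : Fin s → PSpace n) (I : Finset (Fin s)) :
    Projectivization.Subspace ℂ (Fin (n + 1) → ℂ) :=
  Projectivization.Subspace.span (p '' (I : Set (Fin s)))

/-- The number `k_I = max (∑_{i ∈ I} m_i - r d, 0)`, for `I` of cardinality `r + 1`. -/
def expMult {s : ℕ} (d : ℕ) (m : Fin s → ℕ) (r : ℕ) (I : Finset (Fin s)) : ℕ :=
  (max ((∑ i ∈ I, (m i : ℤ)) - (r : ℤ) * (d : ℤ)) 0).toNat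

end

end LinSys

namespace LinSys

open MvPolynomial

/-! Added general points of multiplicity 0 reduce to `s = n + 2`. Take all points but one outside
`I` as coordinate points: multiplicity `m i` at a coordinate point bounds the degree in that
variable by `d - m i`, so every monomial has degree at least `d - ∑ i ∈ I, (d - m i) = ∑ i ∈ I, m i
- r * d` in the variables vanishing on `L_I`. This is the lower bound
(`GeneralVectors.natCast_le_orderAt_of_mem_span`).

For sharpness, non-emptiness forces `m i ≤ d` and `∑ m i ≤ n * d`, the latter by a Cremona
transformation (`GeneralVectors.numerical_bounds`). These inequalities allow a product of `d`
hyperplanes, each missing exactly two of the points, in which point `i` is missed at most `d - m i`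
times. A factor contains `L_I` only if both missed points lie outside `I`; `exists_pairing` chooses
the missed pairs so that at most `k_I` factors do (`GeneralVectors.exists_form`). -/

theorem natCast_le_orderAt_iff {n : ℕ} {f : MvPolynomial (Fin (n + 1)) ℂ} {v : Fin (n + 1) → ℂ}
    {k : ℕ} : (k : ℕ∞) ≤ orderAt f v ↔
      aeval (fun j => X j + C (v j)) f ∈ idealOfVars (Fin (n + 1)) ℂ ^ k := by
  rw [mem_pow_idealOfVars_iff', orderAt]
  constructor
  · intro h x hx
    rw [← MvPolynomial.coeff_coe]
    exact MvPowerSeries.coeff_of_lt_order (lt_of_lt_of_le (by exact_mod_cast hx) h)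
  · intro h
    refine MvPowerSeries.nat_le_order fun x hx => ?_
    rw [MvPolynomial.coeff_coe]
    exact h x hx

/-- A polynomial vanishing to order `k` at `v` takes values in `J ^ k` at all points congruent
to `v` modulo `J`. -/
theorem aeval_mem_pow_of_le_orderAt {n : ℕ} {f : MvPolynomial (Fin (n + 1)) ℂ}
    {v : Fin (n + 1) → ℂ} {k : ℕ} (h : (k : ℕ∞) ≤ orderAt f v) {S : Type*} [CommRing S]
    [Algebra ℂ S] (J : Ideal S) (z : Fin (n + 1) → S) (hz : ∀ j, z j - algebraMap ℂ S (v j) ∈ J) :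
    aeval z f ∈ J ^ k := by
  rw [natCast_le_orderAt_iff] at h
  let φ : MvPolynomial (Fin (n + 1)) ℂ →ₐ[ℂ] S := aeval fun j => z j - algebraMap ℂ S (v j)
  have hφ : φ (aeval (fun j => X j + C (v j)) f) = aeval z f := by
    rw [← AlgHom.comp_apply]
    congr 1
    ext j
    simp [φ]
  rw [← hφ]
  have hJ : (idealOfVars (Fin (n + 1)) ℂ).map φ ≤ J := by
    rw [Ideal.map_span, Ideal.span_le]
    rintro _ ⟨_, ⟨j, rfl⟩, rfl⟩
    simpa [φ] using hz j
  have := Ideal.mem_map_of_mem φ h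
  rw [Ideal.map_pow] at this
  exact Ideal.pow_right_mono hJ k this

theorem degree_eq_of_mem_support {σ : Type*} {d : ℕ} {f : MvPolynomial σ ℂ}
    (hf : f.IsHomogeneous d) {α : σ →₀ ℕ} (hα : α ∈ f.support) : α.degree = d := by
  have h := hf (mem_support_iff.1 hα)
  rw [← h, Finsupp.degree_eq_weight_one]
  rfl

theorem orderAt_prod {n : ℕ} {ι : Type*} (s : Finset ι) (f : ι → MvPolynomial (Fin (n + 1)) ℂ)
    (v : Fin (n + 1) → ℂ) : orderAt (∏ t ∈ s, f t) v = ∑ t ∈ s, orderAt (f t) v := by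
  classical
  induction s using Finset.induction_on with
  | empty =>
    simp only [Finset.prod_empty, Finset.sum_empty, orderAt, map_one, MvPolynomial.coe_one]
    exact MvPowerSeries.weightedOrder_one _
  | insert a s ha ih =>
    rw [Finset.prod_insert ha, Finset.sum_insert ha, ← ih]
    simp only [orderAt, map_mul, MvPolynomial.coe_mul, MvPowerSeries.order_mul]

/-! ### Linear forms and linear changes of coordinates. -/

/-- The linear form with the same values as the functional `ℓ`. -/
noncomputable def linForm {n : ℕ} (ℓ : Module.Dual ℂ (Fin (n + 1) → ℂ)) :
    MvPolynomial (Fin (n + 1)) ℂ :=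
  ∑ k, C (ℓ (Pi.single k 1)) * X k

theorem dual_apply_eq_sum {n : ℕ} (ℓ : Module.Dual ℂ (Fin (n + 1) → ℂ)) (x : Fin (n + 1) → ℂ) :
    ℓ x = ∑ k, ℓ (Pi.single k 1) * x k := by
  conv_lhs => rw [pi_eq_sum_univ' x, map_sum]
  refine Finset.sum_congr rfl fun k _ => ?_
  rw [map_smul, smul_eq_mul, mul_comm]

theorem eval_linForm {n : ℕ} (ℓ : Module.Dual ℂ (Fin (n + 1) → ℂ)) (x : Fin (n + 1) → ℂ) :
    eval x (linForm ℓ) = ℓ x := by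
  simp [linForm, dual_apply_eq_sum ℓ x]

theorem isHomogeneous_linForm {n : ℕ} (ℓ : Module.Dual ℂ (Fin (n + 1) → ℂ)) :
    (linForm ℓ).IsHomogeneous 1 :=
  IsHomogeneous.sum _ _ _ fun k _ => isHomogeneous_C_mul_X _ k

theorem linForm_mem_idealOfVars {n : ℕ} (ℓ : Module.Dual ℂ (Fin (n + 1) → ℂ)) :
    linForm ℓ ∈ idealOfVars (Fin (n + 1)) ℂ :=
  Ideal.sum_mem _ fun k _ => Ideal.mul_mem_left _ _ (Ideal.subset_span ⟨k, rfl⟩)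

theorem aeval_add_C_linForm {n : ℕ} (ℓ : Module.Dual ℂ (Fin (n + 1) → ℂ)) (v : Fin (n + 1) → ℂ) :
    aeval (fun j => X j + C (v j)) (linForm ℓ) = linForm ℓ + C (ℓ v) := by
  simp only [linForm, map_sum, map_mul, aeval_X, dual_apply_eq_sum ℓ v, mul_add,
    Finset.sum_add_distrib, aeval_C, algebraMap_eq]

theorem one_le_orderAt_linForm {n : ℕ} {ℓ : Module.Dual ℂ (Fin (n + 1) → ℂ)}
    {v : Fin (n + 1) → ℂ} (h : ℓ v = 0) : 1 ≤ orderAt (linForm ℓ) v := by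
  have := (natCast_le_orderAt_iff (f := linForm ℓ) (v := v) (k := 1)).2 (by
    rw [aeval_add_C_linForm, h, map_zero, add_zero, pow_one]
    exact linForm_mem_idealOfVars ℓ)
  exact_mod_cast this

theorem orderAt_linForm_eq_zero {n : ℕ} {ℓ : Module.Dual ℂ (Fin (n + 1) → ℂ)}
    {v : Fin (n + 1) → ℂ} (h : ℓ v ≠ 0) : orderAt (linForm ℓ) v = 0 := by
  by_contra hne
  have h1 : ((1 : ℕ) : ℕ∞) ≤ orderAt (linForm ℓ) v := by
    exact_mod_cast Order.one_le_iff_pos.2 (pos_iff_ne_zero.2 hne)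
  -- Modulo the zero ideal, order at least 1 says that the value at `v` is 0.
  have := aeval_mem_pow_of_le_orderAt h1 (⊥ : Ideal ℂ) v (by simp)
  rw [pow_one, Ideal.mem_bot, aeval_eq_eval] at this
  exact h ((eval_linForm ℓ v).symm.trans this)

theorem orderAt_linForm_le_one {n : ℕ} {ℓ : Module.Dual ℂ (Fin (n + 1) → ℂ)} (h : ℓ ≠ 0)
    (v : Fin (n + 1) → ℂ) : orderAt (linForm ℓ) v ≤ 1 := by
  obtain ⟨k, hk⟩ : ∃ k, ℓ (Pi.single k 1) ≠ 0 := by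
    by_contra! hall
    exact h (LinearMap.ext fun x => by simp [dual_apply_eq_sum ℓ x, hall])
  have hc : MvPowerSeries.coeff (Finsupp.single k 1)
      ((linForm ℓ + C (ℓ v) : MvPolynomial (Fin (n + 1)) ℂ) : MvPowerSeries (Fin (n + 1)) ℂ)
      ≠ 0 := by
    rw [MvPolynomial.coeff_coe]
    have : (0 : Fin (n + 1) →₀ ℕ) ≠ Finsupp.single k 1 := by
      simp [eq_comm]
    simpa [linForm, coeff_sum, coeff_C_mul, coeff_X, coeff_C, this, Finsupp.single_left_inj]
      using hk
  have := MvPowerSeries.order_le hc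
  rw [orderAt, aeval_add_C_linForm]
  simpa using this

/-- The polynomial `f ∘ A`, for a linear map `A`. -/
noncomputable def linSubst {n : ℕ} (A : (Fin (n + 1) → ℂ) →ₗ[ℂ] (Fin (n + 1) → ℂ))
    (f : MvPolynomial (Fin (n + 1)) ℂ) : MvPolynomial (Fin (n + 1)) ℂ :=
  aeval (fun j => linForm (LinearMap.proj j ∘ₗ A)) f

theorem eval_linSubst {n : ℕ} (A : (Fin (n + 1) → ℂ) →ₗ[ℂ] (Fin (n + 1) → ℂ))
    (f : MvPolynomial (Fin (n + 1)) ℂ) (x : Fin (n + 1) → ℂ) :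
    eval x (linSubst A f) = eval (A x) f := by
  rw [linSubst, ← MvPolynomial.coe_aeval_eq_eval, ← MvPolynomial.coe_aeval_eq_eval]
  change aeval x (aeval _ f) = aeval (A x) f
  rw [← AlgHom.comp_apply]
  congr 1
  ext j
  simp [MvPolynomial.aeval_eq_eval, eval_linForm]

theorem linSubst_linSubst_symm {n : ℕ} (A : (Fin (n + 1) → ℂ) ≃ₗ[ℂ] (Fin (n + 1) → ℂ))
    (f : MvPolynomial (Fin (n + 1)) ℂ) :
    linSubst A.symm.toLinearMap (linSubst A.toLinearMap f) = f :=
  MvPolynomial.funext fun x => by simp [eval_linSubst]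

theorem isHomogeneous_linSubst {n d : ℕ} (A : (Fin (n + 1) → ℂ) →ₗ[ℂ] (Fin (n + 1) → ℂ))
    {f : MvPolynomial (Fin (n + 1)) ℂ} (hf : f.IsHomogeneous d) :
    (linSubst A f).IsHomogeneous d := by
  rw [linSubst, ← one_mul d]
  refine IsHomogeneous.aeval hf _ fun j => ?_
  exact isHomogeneous_linForm _

theorem natCast_le_orderAt_linSubst {n k : ℕ} (A : (Fin (n + 1) → ℂ) →ₗ[ℂ] (Fin (n + 1) → ℂ))
    {f : MvPolynomial (Fin (n + 1)) ℂ} {w : Fin (n + 1) → ℂ}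
    (h : (k : ℕ∞) ≤ orderAt f (A w)) : (k : ℕ∞) ≤ orderAt (linSubst A f) w := by
  rw [natCast_le_orderAt_iff, linSubst, ← AlgHom.comp_apply, comp_aeval]
  refine aeval_mem_pow_of_le_orderAt h _ _ fun j => ?_
  rw [aeval_add_C_linForm]
  simpa using linForm_mem_idealOfVars (LinearMap.proj j ∘ₗ A)

theorem natCast_le_orderAt_of_linSubst {n k : ℕ}
    (A : (Fin (n + 1) → ℂ) ≃ₗ[ℂ] (Fin (n + 1) → ℂ))
    {f : MvPolynomial (Fin (n + 1)) ℂ} {w : Fin (n + 1) → ℂ}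
    (h : (k : ℕ∞) ≤ orderAt (linSubst A.toLinearMap f) (A.symm w)) :
    (k : ℕ∞) ≤ orderAt f w := by
  simpa only [linSubst_linSubst_symm] using natCast_le_orderAt_linSubst A.symm.toLinearMap h

/-! ### Multiplicities and exponents of monomials. -/

/-- A form of degree `d` with multiplicity `m` at a coordinate point has degree at most `d - m`
in the corresponding variable. -/
theorem apply_add_le_of_le_orderAt_single {n d m : ℕ} {f : MvPolynomial (Fin (n + 1)) ℂ}
    (hf : f.IsHomogeneous d) {k : Fin (n + 1)} {a : ℂ} (ha : a ≠ 0)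
    (h : (m : ℕ∞) ≤ orderAt f (Pi.single k a)) {α : Fin (n + 1) →₀ ℕ} (hα : α ∈ f.support) :
    α k + m ≤ d := by
  classical
  have hdeg : ∀ β ∈ f.support, (β.erase k).degree + β k = d := fun β hβ => by
    rw [← degree_eq_of_mem_support hf hβ]
    conv_rhs => rw [← Finsupp.single_add_erase k β]
    simp [add_comm]
  -- Dehomogenize at `x_k = a`. By homogeneity distinct monomials stay distinct, so no coefficients
  -- cancel.
  let z : Fin (n + 1) → MvPolynomial (Fin (n + 1)) ℂ := fun j => if j = k then C a else X j
  have hz : aeval z f ∈ idealOfVars (Fin (n + 1)) ℂ ^ m := by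
    refine aeval_mem_pow_of_le_orderAt h _ _ fun j => ?_
    by_cases hj : j = k
    · subst hj; simp [z]
    · simpa [z, hj] using Ideal.subset_span (Set.mem_range_self j)
  have hmon : ∀ β : Fin (n + 1) →₀ ℕ, aeval z (monomial β (coeff β f)) =
      monomial (β.erase k) (coeff β f * a ^ β k) := fun β => by
    rw [aeval_monomial, Finsupp.prod_fintype _ _ (by simp),
      ← Finset.mul_prod_erase _ _ (Finset.mem_univ k), monomial_eq (s := β.erase k),
      Finsupp.prod_fintype _ _ (by simp), ← Finset.mul_prod_erase _ _ (Finset.mem_univ k)]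
    have : ∏ x ∈ Finset.univ.erase k, z x ^ β x =
        ∏ x ∈ Finset.univ.erase k, (X x : MvPolynomial (Fin (n + 1)) ℂ) ^ (β.erase k) x :=
      Finset.prod_congr rfl fun x hx => by
        have hx : x ≠ k := Finset.ne_of_mem_erase hx
        simp [z, hx, Finsupp.erase_ne hx]
    rw [this]
    simp [z, mul_assoc]
  have hcoeff : coeff (α.erase k) (aeval z f) = coeff α f * a ^ α k := by
    conv_lhs => rw [f.as_sum, map_sum, coeff_sum]
    rw [Finset.sum_eq_single α]
    · rw [hmon, coeff_monomial, if_pos rfl]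
    · intro β hβ hne
      rw [hmon, coeff_monomial, if_neg]
      intro he
      apply hne
      have h1 := hdeg α hα
      have h2 := hdeg β hβ
      rw [he] at h2
      rw [← Finsupp.single_add_erase k β, ← Finsupp.single_add_erase k α, he,
        show β k = α k by omega]
    · exact fun hn => absurd hα hn
  have hm : m ≤ (α.erase k).degree := by
    refine (mem_pow_idealOfVars_iff _ _).1 hz _ (mem_support_iff.2 ?_)
    rw [hcoeff]
    exact mul_ne_zero (mem_support_iff.1 hα) (pow_ne_zero _ ha)
  have := hdeg α hα
  omega

/-- If every monomial of `f` has degree at least `k` in the variables outside `K`, then `f` has order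
at least `k` along the coordinate subspace where these variables vanish. -/
theorem natCast_le_orderAt_of_forall_sum_compl {n k : ℕ} {f : MvPolynomial (Fin (n + 1)) ℂ}
    (K : Finset (Fin (n + 1))) (hf : ∀ α ∈ f.support, k ≤ ∑ i ∈ Kᶜ, α i)
    {w : Fin (n + 1) → ℂ} (hw : ∀ i ∉ K, w i = 0) : (k : ℕ∞) ≤ orderAt f w := by
  rw [natCast_le_orderAt_iff, f.as_sum, map_sum]
  refine Ideal.sum_mem _ fun α hα => ?_
  rw [aeval_monomial, Finsupp.prod_fintype _ _ (by simp), ← Finset.prod_mul_prod_compl K]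
  refine Ideal.mul_mem_left _ _ (Ideal.mul_mem_left _ _ ?_)
  refine Ideal.pow_le_pow_right (hf α hα) ?_
  rw [← Finset.prod_pow_eq_pow_sum]
  refine Ideal.prod_mem_prod fun i hi => Ideal.pow_mem_pow ?_ _
  rw [hw i (Finset.mem_compl.1 hi), map_zero, add_zero]
  exact Ideal.subset_span (Set.mem_range_self i)

/-- A nonzero form of degree `d` and of degree at most `c i` in each variable has multiplicity at
most `∑ c i - d` at the unit point: its Cremona transform has degree `∑ c i - d`. -/
theorem add_le_sum_of_le_orderAt_one {n d m : ℕ} {f : MvPolynomial (Fin (n + 1)) ℂ} (hf0 : f ≠ 0)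
    (hf : f.IsHomogeneous d) {c : Fin (n + 1) → ℕ} (hc : ∀ α ∈ f.support, ∀ i, α i ≤ c i)
    (h : (m : ℕ∞) ≤ orderAt f 1) : m + d ≤ ∑ i, c i := by
  classical
  let c' : Fin (n + 1) →₀ ℕ := Finsupp.equivFunOnFinite.symm c
  -- The Cremona transform `x ^ c * f(1 / x)`.
  let g : MvPolynomial (Fin (n + 1)) ℂ := ∑ α ∈ f.support, monomial (c' - α) (coeff α f)
  have hdeg : ∀ α ∈ f.support, ∑ i, (c i - α i) + d = ∑ i, c i := fun α hα => by
    rw [← degree_eq_of_mem_support hf hα, Finsupp.degree_eq_sum, ← Finset.sum_add_distrib]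
    exact Finset.sum_congr rfl fun i _ => Nat.sub_add_cancel (hc α hα i)
  have hg0 : g ≠ 0 := by
    obtain ⟨α, hα⟩ := support_nonempty.2 hf0
    refine ne_zero_iff.2 ⟨c' - α, ?_⟩
    rw [coeff_sum, Finset.sum_eq_single α]
    · simpa using hα
    · intro β hβ hne
      rw [coeff_monomial, if_neg]
      intro he
      apply hne
      ext i
      have h1 := DFunLike.congr_fun he i
      have h2 := hc α hα i
      have h3 := hc β hβ i
      simp only [Finsupp.coe_tsub, Pi.sub_apply, c', Finsupp.equivFunOnFinite_symm_apply_apply]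
        at h1
      omega
    · exact fun hn => absurd hα hn
  obtain ⟨x, hx⟩ : ∃ x, eval x g ≠ 0 := by
    by_contra! hall
    exact hg0 (MvPolynomial.funext fun x => by simpa using hall x)
  -- The line from the unit point (parameter 0) to `x` (parameter 1); `P` is `g` restricted to it,
  -- nonzero since `g` does not vanish at `x`.
  let u : Fin (n + 1) → Polynomial ℂ := fun i => 1 + Polynomial.X * Polynomial.C (x i - 1)
  let P : Polynomial ℂ := ∑ α ∈ f.support,
    Polynomial.C (coeff α f) * ∏ i, u i ^ (c i - α i)
  have hP0 : P ≠ 0 := by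
    intro hP
    apply hx
    have : Polynomial.eval 1 P = eval x g := by
      simp [P, g, u, Polynomial.eval_finsetSum, Polynomial.eval_prod, eval_monomial,
        Finsupp.prod_fintype, c']
    rw [← this, hP, Polynomial.eval_zero]
  have hPdeg : P.natDegree ≤ ∑ i, c i - d := by
    refine Polynomial.natDegree_sum_le_of_forall_le _ _ fun α hα => ?_
    refine (Polynomial.natDegree_C_mul_le _ _).trans ((Polynomial.natDegree_prod_le _ _).trans ?_)
    rw [show ∑ i, c i - d = ∑ i, (c i - α i) by have := hdeg α hα; omega]
    refine Finset.sum_le_sum fun i _ => ?_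
    have hu : (u i).natDegree ≤ 1 := (Polynomial.natDegree_add_le _ _).trans
      (max_le (by simp) ((Polynomial.natDegree_mul_C_le _ _).trans (by simp)))
    simpa using Polynomial.natDegree_pow_le_of_le (c i - α i) hu
  have hdvd : (Polynomial.X : Polynomial ℂ) ^ m ∣ P := by
    -- As power series the `u i` are invertible with inverse congruent to 1 modulo `X`, so `P = u ^
    -- c * f(1 / u)` inherits the order of `f` at the unit point.
    let U : Fin (n + 1) → PowerSeries ℂ := fun i => (u i : PowerSeries ℂ)
    have hU : ∀ i, PowerSeries.constantCoeff (U i) = 1 := fun i => by simp [U, u]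
    have hUinv : ∀ i, U i * (U i)⁻¹ = 1 := fun i =>
      PowerSeries.mul_inv_cancel _ (by rw [hU]; exact one_ne_zero)
    have hmem := aeval_mem_pow_of_le_orderAt h (Ideal.span {(PowerSeries.X : PowerSeries ℂ)})
      (fun i => (U i)⁻¹) fun i => by
        rw [Ideal.mem_span_singleton, PowerSeries.X_dvd_iff]
        simp [hU]
    rw [Ideal.span_singleton_pow, Ideal.mem_span_singleton] at hmem
    have hP : (P : PowerSeries ℂ) = (∏ i, U i ^ c i) * aeval (fun i => (U i)⁻¹) f := by
      conv_rhs => rw [f.as_sum, map_sum, Finset.mul_sum]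
      simp only [P, ← Polynomial.coeToPowerSeries.ringHom_apply, map_sum, map_mul, map_prod,
        map_pow]
      refine Finset.sum_congr rfl fun α hα => ?_
      rw [aeval_monomial, Finsupp.prod_fintype _ _ (by simp), mul_left_comm,
        ← Finset.prod_mul_distrib]
      congr 1
      · simp
      · refine Finset.prod_congr rfl fun i _ => ?_
        have : c i = (c i - α i) + α i := (Nat.sub_add_cancel (hc α hα i)).symm
        conv_rhs => rw [this, pow_add, mul_assoc, ← mul_pow, hUinv, one_pow, mul_one]
        simp [U]
    rw [Polynomial.X_pow_dvd_iff]
    intro k hk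
    rw [← Polynomial.coeff_coe, hP]
    exact PowerSeries.X_pow_dvd_iff.1 (hmem.mul_left _) k hk
  have hm := (Polynomial.natDegree_le_of_dvd hdvd hP0).trans hPdeg
  rw [Polynomial.natDegree_X_pow] at hm
  obtain ⟨α, hα⟩ := support_nonempty.2 hf0
  have := hdeg α hα
  omega

/-! ### Vectors in general position: the lower bound and the numerical conditions. -/

/-- A family of vectors in linearly general position: any `n + 1` of them are independent. -/
def GeneralVectors {n N : ℕ} (v : Fin N → Fin (n + 1) → ℂ) : Prop :=
  ∀ I : Finset (Fin N), I.card ≤ n + 1 → LinearIndepOn ℂ v (I : Set (Fin N))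

theorem GeneralVectors.linearIndependent_succAbove {n : ℕ} {v : Fin (n + 2) → Fin (n + 1) → ℂ}
    (hv : GeneralVectors v) (j : Fin (n + 2)) :
    LinearIndependent ℂ fun k => v (j.succAbove k) := by
  have h := hv (Finset.univ.map (Fin.succAboveEmb j)) (by simp)
  exact h.comp (fun k => ⟨j.succAbove k, by simp⟩)
    fun a b hab => Fin.succAbove_right_injective (congrArg Subtype.val hab)

/-- The basis formed by all the vectors but the `j`-th. -/
noncomputable def GeneralVectors.basis {n : ℕ} {v : Fin (n + 2) → Fin (n + 1) → ℂ}
    (hv : GeneralVectors v) (j : Fin (n + 2)) : Module.Basis (Fin (n + 1)) ℂ (Fin (n + 1) → ℂ) :=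
  basisOfLinearIndependentOfCardEqFinrank (hv.linearIndependent_succAbove j) (by simp)

theorem GeneralVectors.basis_apply {n : ℕ} {v : Fin (n + 2) → Fin (n + 1) → ℂ}
    (hv : GeneralVectors v) (j : Fin (n + 2)) (k : Fin (n + 1)) :
    hv.basis j k = v (j.succAbove k) := by
  simp [GeneralVectors.basis]

theorem GeneralVectors.eq_zero_of_forall_succAbove {n : ℕ} {v : Fin (n + 2) → Fin (n + 1) → ℂ}
    (hv : GeneralVectors v) (j : Fin (n + 2)) {ℓ : Module.Dual ℂ (Fin (n + 1) → ℂ)}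
    (h : ∀ i ≠ j, ℓ (v i) = 0) : ℓ = 0 :=
  (hv.basis j).ext fun k => by simp [hv.basis_apply, h _ (Fin.succAbove_ne j k)]

/-- Through all the points but two there passes a hyperplane that misses these two. -/
theorem GeneralVectors.exists_dual {n : ℕ} {v : Fin (n + 2) → Fin (n + 1) → ℂ}
    (hv : GeneralVectors v) {a b : Fin (n + 2)} (hab : a ≠ b) :
    ∃ ℓ : Module.Dual ℂ (Fin (n + 1) → ℂ), ∀ i, ℓ (v i) = 0 ↔ i ≠ a ∧ i ≠ b := by
  obtain ⟨k, rfl⟩ := Fin.exists_succAbove_eq hab.symm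
  have h1 : ∀ i, (hv.basis a).coord k (v (a.succAbove i)) = if i = k then 1 else 0 := fun i => by
    rw [← hv.basis_apply, Module.Basis.coord_apply, Module.Basis.repr_self, Finsupp.single_apply]
  have h2 : (hv.basis a).coord k (v a) ≠ 0 := fun h => by
    -- Otherwise the coordinate would vanish on all vectors but one, and these form a basis.
    have h0 : (hv.basis a).coord k = 0 :=
        hv.eq_zero_of_forall_succAbove (a.succAbove k) fun i hi => by
      rcases eq_or_ne i a with rfl | hia
      · exact h
      · obtain ⟨l, rfl⟩ := Fin.exists_succAbove_eq hia
        rw [h1, if_neg (by rintro rfl; exact hi rfl)]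
    have := h1 k
    rw [h0, if_pos rfl] at this
    simp at this
  refine ⟨(hv.basis a).coord k, fun i => ?_⟩
  rcases eq_or_ne i a with rfl | hia
  · simpa using h2
  · obtain ⟨l, rfl⟩ := Fin.exists_succAbove_eq hia
    rw [h1]
    simp

theorem GeneralVectors.natCast_le_orderAt_of_mem_span {n d r k : ℕ}
    {v : Fin (n + 2) → Fin (n + 1) → ℂ} (hv : GeneralVectors v) {m : Fin (n + 2) → ℕ}
    {f : MvPolynomial (Fin (n + 1)) ℂ} (hf : f.IsHomogeneous d)
    (hm : ∀ i, (m i : ℕ∞) ≤ orderAt f (v i)) {I : Finset (Fin (n + 2))} (hI : I.card = r + 1)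
    (hr : r + 1 ≤ n) (hk : k + r * d ≤ ∑ i ∈ I, m i) {w : Fin (n + 1) → ℂ}
    (hw : w ∈ Submodule.span ℂ (v '' I)) : (k : ℕ∞) ≤ orderAt f w := by
  classical
  obtain ⟨j, hj⟩ : ∃ j, j ∉ I := by
    by_contra! hall
    rw [Finset.eq_univ_of_forall hall] at hI
    simp at hI
    omega
  let A : (Fin (n + 1) → ℂ) ≃ₗ[ℂ] (Fin (n + 1) → ℂ) := (hv.basis j).equivFun.symm
  have hA : ∀ l, A (Pi.single l 1) = v (j.succAbove l) := fun l => by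
    rw [← hv.basis_apply]; simp [A, Module.Basis.equivFun_symm_apply, Pi.single_apply]
  have hA' : ∀ l, A.symm (v (j.succAbove l)) = Pi.single l 1 := fun l => by
    rw [← hA, LinearEquiv.symm_apply_apply]
  let K : Finset (Fin (n + 1)) := Finset.univ.filter fun l => j.succAbove l ∈ I
  have hKI : K.map (Fin.succAboveEmb j) = I := by
    ext i
    simp only [Finset.mem_map, K, Finset.mem_filter, Finset.mem_univ, true_and,
      Fin.succAboveEmb_apply]
    constructor
    · rintro ⟨l, hl, rfl⟩; exact hl
    · intro hi
      obtain ⟨l, rfl⟩ := Fin.exists_succAbove_eq (x := i) (y := j) (by rintro rfl; exact hj hi)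
      exact ⟨l, hi, rfl⟩
  refine natCast_le_orderAt_of_linSubst A
    (natCast_le_orderAt_of_forall_sum_compl K (fun α hα => ?_) ?_)
  · have hsupp : ∀ l, α l + m (j.succAbove l) ≤ d := fun l =>
      apply_add_le_of_le_orderAt_single (isHomogeneous_linSubst A.toLinearMap hf) one_ne_zero
        (natCast_le_orderAt_linSubst A.toLinearMap (by
          rw [LinearEquiv.coe_coe, hA]; exact hm _)) hα
    -- Summing the bounds over `I` caps the degree in the variables of `K`; homogeneity puts the
    -- rest outside `K`.
    have h1 : ∑ l ∈ K, α l + ∑ i ∈ I, m i ≤ (r + 1) * d := by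
      rw [← hI, ← hKI, Finset.sum_map, ← Finset.sum_add_distrib, Finset.card_map]
      exact Finset.sum_le_card_nsmul _ _ _ fun l _ => hsupp l
    have h2 := degree_eq_of_mem_support (isHomogeneous_linSubst A.toLinearMap hf) hα
    rw [Finsupp.degree_eq_sum, ← Finset.sum_add_sum_compl K] at h2
    rw [add_mul, one_mul] at h1
    omega
  · intro l hl
    have hle : Submodule.span ℂ (v '' I) ≤
        LinearMap.ker (LinearMap.proj l ∘ₗ A.symm.toLinearMap) := by
      rw [Submodule.span_le]
      rintro _ ⟨i, hi, rfl⟩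
      obtain ⟨l', rfl⟩ := Fin.exists_succAbove_eq (x := i) (y := j) (by rintro rfl; exact hj hi)
      have : l ≠ l' := by
        rintro rfl
        exact hl (by simpa [K] using hi)
      simp [hA', this]
    simpa using hle hw

/-- With `v j` as unit point and the others on the coordinate axes, the Cremona transform has degree
at most `∑ i ≠ j, (d - m i) - d`, which must be at least `m j`. -/
theorem GeneralVectors.numerical_bounds {n d : ℕ}
    {v : Fin (n + 2) → Fin (n + 1) → ℂ} (hv : GeneralVectors v) {m : Fin (n + 2) → ℕ}
    {f : MvPolynomial (Fin (n + 1)) ℂ} (hf0 : f ≠ 0) (hf : f.IsHomogeneous d)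
    (hm : ∀ i, (m i : ℕ∞) ≤ orderAt f (v i)) : (∀ i, m i ≤ d) ∧ ∑ i, m i ≤ n * d := by
  have key : ∀ j : Fin (n + 2), (∀ k, m (j.succAbove k) ≤ d) ∧ ∑ i, m i ≤ n * d := fun j => by
    let b := hv.basis j
    have ha : ∀ k, b.repr (v j) k ≠ 0 := fun k h => by
      obtain ⟨ℓ, hℓ⟩ := hv.exists_dual (Fin.succAbove_ne j k).symm
      have h1 : ℓ (v j) = 0 := by
        rw [← b.sum_repr (v j), map_sum]
        refine Finset.sum_eq_zero fun l _ => ?_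
        rw [map_smul]
        rcases eq_or_ne l k with rfl | hl
        · rw [h, zero_smul]
        · rw [hv.basis_apply, (hℓ _).2 ⟨Fin.succAbove_ne j l,
            fun he => hl (Fin.succAbove_right_injective he)⟩, smul_zero]
      exact ((hℓ j).1 h1).1 rfl
    -- Rescaling makes `v j` the all-ones vector, at the price that the other vectors become
    -- multiples of the coordinate vectors.
    let b' := b.unitsSMul fun k => Units.mk0 _ (ha k)
    let A : (Fin (n + 1) → ℂ) ≃ₗ[ℂ] (Fin (n + 1) → ℂ) := b'.equivFun.symm
    have hA : ∀ k, A (Pi.single k (b.repr (v j) k)⁻¹) = v (j.succAbove k) := fun k => by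
      have : b k = v (j.succAbove k) := hv.basis_apply j k
      simp [A, b', Module.Basis.equivFun_symm_apply, Pi.single_apply, Module.Basis.unitsSMul_apply,
        Units.smul_def, smul_smul, inv_mul_cancel₀ (ha k), this]
    have hA1 : A 1 = v j := by
      conv_rhs => rw [← b.sum_repr (v j)]
      simp [A, b', Module.Basis.equivFun_symm_apply, Module.Basis.unitsSMul_apply, Units.smul_def]
    have hhom := isHomogeneous_linSubst A.toLinearMap hf
    have hne : linSubst A.toLinearMap f ≠ 0 := fun h0 => hf0 (by
      rw [← linSubst_linSubst_symm A f, h0]; simp [linSubst])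
    have hsupp : ∀ α ∈ (linSubst A.toLinearMap f).support, ∀ k, α k + m (j.succAbove k) ≤ d :=
      fun α hα k => apply_add_le_of_le_orderAt_single hhom (inv_ne_zero (ha k))
        (natCast_le_orderAt_linSubst A.toLinearMap (by
          rw [LinearEquiv.coe_coe, hA]; exact hm _)) hα
    obtain ⟨α, hα⟩ := support_nonempty.2 hne
    have hle : ∀ k, m (j.succAbove k) ≤ d := fun k => (Nat.le_add_left _ _).trans (hsupp α hα k)
    refine ⟨hle, ?_⟩
    have h1 := add_le_sum_of_le_orderAt_one (m := m j) hne hhom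
      (c := fun k => d - m (j.succAbove k))
      (fun β hβ k => by have := hsupp β hβ k; omega)
      (natCast_le_orderAt_linSubst A.toLinearMap (by
          rw [LinearEquiv.coe_coe, hA1]; exact hm _))
    have h2 : ∑ k, (d - m (j.succAbove k)) + ∑ k, m (j.succAbove k) = (n + 1) * d := by
      rw [← Finset.sum_add_distrib, Finset.sum_congr rfl fun k _ => Nat.sub_add_cancel (hle k)]
      simp
    rw [add_mul, one_mul] at h2
    rw [Fin.sum_univ_succAbove _ j]
    omega
  refine ⟨fun i => ?_, (key 0).2⟩
  obtain ⟨j, hj⟩ := exists_ne i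
  obtain ⟨k, rfl⟩ := Fin.exists_succAbove_eq hj.symm
  exact (key j).1 k

/-! ### Choosing the pairs of missed points. -/

/-- In the concatenation of blocks of `c i` copies of `i`, for distinct `i`, two positions holding
the same `i` are at distance less than `c i`. -/
theorem sub_lt_of_flatMap_replicate {ι : Type*} (c : ι → ℕ) (L : List ι) (hL : L.Nodup)
    {s t : ℕ} (hst : s ≤ t) {i : ι}
    (hs : (L.flatMap fun i => List.replicate (c i) i)[s]? = some i)
    (ht : (L.flatMap fun i => List.replicate (c i) i)[t]? = some i) : t - s < c i := by
  induction L generalizing s t with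
  | nil => simp at hs
  | cons x L ih =>
    rw [List.nodup_cons] at hL
    have hmem : ∀ u, (L.flatMap fun i => List.replicate (c i) i)[u]? = some i → i ∈ L :=
      fun u hu => by
        have := List.mem_of_getElem? hu
        simp only [List.mem_flatMap, List.mem_replicate] at this
        obtain ⟨y, hy, -, rfl⟩ := this
        exact hy
    rw [List.flatMap_cons, List.getElem?_append, List.length_replicate] at hs ht
    by_cases h1 : t < c x
    · have hx : x = i := by
        rw [if_pos (hst.trans_lt h1), List.getElem?_replicate, if_pos (hst.trans_lt h1)] at hs
        simpa using hs
      subst hx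
      omega
    · rw [if_neg h1] at ht
      by_cases h2 : s < c x
      · rw [if_pos h2, List.getElem?_replicate, if_pos h2] at hs
        have hx : x = i := by simpa using hs
        subst hx
        exact absurd (hmem _ ht) hL.1
      · rw [if_neg h2] at hs
        have := ih hL.2 (by omega) hs ht
        omega

theorem card_le_of_forall_sub_lt {c : ℕ} (S : Finset ℕ)
    (h : ∀ s ∈ S, ∀ t ∈ S, s ≤ t → t - s < c) : S.card ≤ c := by
  rcases S.eq_empty_or_nonempty with rfl | hS
  · simp
  · have : S ⊆ Finset.Ico (S.min' hS) (S.min' hS + c) := fun t ht => by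
      have h1 := S.min'_le t ht
      have h2 := h _ (S.min'_mem hS) t ht h1
      rw [Finset.mem_Ico]
      omega
    simpa using Finset.card_le_card this

/-- A loopless multigraph with `d` edges, with degrees bounded by `c`, that has as few edges as
possible outside `I`. -/
theorem exists_pairing {N d : ℕ} {c : Fin N → ℕ} (hc : ∀ i, c i ≤ d) (hsum : 2 * d ≤ ∑ i, c i)
    (I : Finset (Fin N)) : ∃ a b : Fin d → Fin N, (∀ t, a t ≠ b t) ∧
      (∀ i, (Finset.univ.filter fun t => a t = i ∨ b t = i).card ≤ c i) ∧
      (Finset.univ.filter fun t => a t ∉ I ∧ b t ∉ I).card ≤ d - ∑ i ∈ I, c i := by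
  -- List `c i` copies of each `i`, with `I` first, and join position `t` to position `t + d`. Equal
  -- entries are less than `c i ≤ d` apart, so there are no loops.
  classical
  let B : Fin N → List (Fin N) := fun i => List.replicate (c i) i
  let l : List (Fin N) := (I.toList ++ Iᶜ.toList).flatMap B
  have hnodup : (I.toList ++ Iᶜ.toList).Nodup := by
    rw [List.nodup_append]
    refine ⟨I.nodup_toList, Iᶜ.nodup_toList, ?_⟩
    rintro x hx y hy rfl
    simp at hx hy
    exact hy hx
  have hlenB : ∀ J : Finset (Fin N), (J.toList.flatMap B).length = ∑ i ∈ J, c i := fun J => by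
    rw [List.length_flatMap]
    simp [B, Finset.sum_map_toList]
  have hlen : 2 * d ≤ l.length := by
    rw [← Finset.sum_add_sum_compl I] at hsum
    simpa [l, List.flatMap_append, hlenB] using hsum
  have hl : ∀ {u : ℕ} (hu : u < l.length), l[u]? = some l[u] := fun hu =>
    List.getElem?_eq_getElem hu
  have hgap : ∀ {s t : ℕ} {i : Fin N}, s ≤ t → l[s]? = some i → l[t]? = some i → t - s < c i :=
    fun hst hs ht => sub_lt_of_flatMap_replicate c _ hnodup hst hs ht
  have hfirst : ∀ {u : ℕ} {i : Fin N}, l[u]? = some i → u < ∑ i ∈ I, c i → i ∈ I :=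
    fun {u i} hu hlt => by
      simp only [l, List.flatMap_append] at hu
      rw [List.getElem?_append, hlenB, if_pos hlt] at hu
      have := List.mem_of_getElem? hu
      simp only [List.mem_flatMap, B, List.mem_replicate, Finset.mem_toList] at this
      obtain ⟨y, hy, -, rfl⟩ := this
      exact hy
  let a : Fin d → Fin N := fun t => l[(t : ℕ)]'(by omega)
  let b : Fin d → Fin N := fun t => l[(t : ℕ) + d]'(by omega)
  have ha : ∀ t : Fin d, l[(t : ℕ)]? = some (a t) := fun t => hl _
  have hb : ∀ t : Fin d, l[(t : ℕ) + d]? = some (b t) := fun t => hl _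
  refine ⟨a, b, fun t hab => ?_, fun i => ?_, ?_⟩
  · have h1 := hgap (Nat.le_add_right _ _) (ha t) (hab ▸ hb t)
    have h2 := hc (a t)
    omega
  -- Each edge at `i` is counted by a position of the list holding `i`.
  · let g : Fin d → ℕ := fun t => if a t = i then t else t + d
    have hg : Function.Injective g := fun s t hst => by
      have := s.2
      have := t.2
      simp only [g] at hst
      ext
      split_ifs at hst <;> omega
    rw [← Finset.card_image_of_injective _ hg]
    have hval : ∀ s ∈ (Finset.univ.filter fun t => a t = i ∨ b t = i).image g,
        l[s]? = some i := fun s hs => by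
      obtain ⟨t, ht, rfl⟩ := Finset.mem_image.1 hs
      simp only [Finset.mem_filter, Finset.mem_univ, true_and] at ht
      by_cases hat : a t = i
      · simp only [g, if_pos hat]
        rw [ha, hat]
      · simp only [g, if_neg hat]
        rw [hb, ht.resolve_left hat]
    exact card_le_of_forall_sub_lt _ fun s hs t ht hst => hgap hst (hval s hs) (hval t ht)
  · rw [← Finset.card_image_of_injective _ Fin.val_injective]
    -- The first `∑ i ∈ I, c i` positions hold elements of `I`.
    have : (Finset.univ.filter fun t => a t ∉ I ∧ b t ∉ I).image Fin.val ⊆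
        Finset.Ico (∑ i ∈ I, c i) d := fun s hs => by
      obtain ⟨t, ht, rfl⟩ := Finset.mem_image.1 hs
      simp only [Finset.mem_filter, Finset.mem_univ, true_and] at ht
      rw [Finset.mem_Ico]
      refine ⟨?_, t.2⟩
      by_contra! hlt
      exact ht.1 (hfirst (ha t) hlt)
    simpa using Finset.card_le_card this

/-! ### The extremal hypersurface. -/

/-- A product of hyperplanes, each through `n` of the points, with the prescribed multiplicities at
the points and the least possible multiplicity at a general point of the span of `I`. -/
theorem GeneralVectors.exists_form {n d : ℕ} {v : Fin (n + 2) → Fin (n + 1) → ℂ}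
    (hv : GeneralVectors v) {m : Fin (n + 2) → ℕ} (hm : ∀ i, m i ≤ d) (hsum : ∑ i, m i ≤ n * d)
    {I : Finset (Fin (n + 2))} (hI : I.Nonempty) :
    ∃ f : MvPolynomial (Fin (n + 1)) ℂ, f ≠ 0 ∧ f.IsHomogeneous d ∧
      (∀ i, (m i : ℕ∞) ≤ orderAt f (v i)) ∧
      ∃ w ∈ Submodule.span ℂ (v '' I), w ≠ 0 ∧ ∀ x : ℂ, x ≠ 0 →
        orderAt f (x • w) ≤ ((d - ∑ i ∈ I, (d - m i) : ℕ) : ℕ∞) := by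
  classical
  have hc : 2 * d ≤ ∑ i, (d - m i) := by
    have : ∑ i, (d - m i) + ∑ i, m i = (n + 2) * d := by
      rw [← Finset.sum_add_distrib, Finset.sum_congr rfl fun i _ => Nat.sub_add_cancel (hm i)]
      simp
    rw [add_mul] at this
    omega
  obtain ⟨a, b, hab, hdeg, hout⟩ := exists_pairing (fun i => Nat.sub_le d (m i)) hc I
  choose ℓ hℓ using fun t => hv.exists_dual (hab t)
  have hℓ0 : ∀ t, ℓ t ≠ 0 := fun t h => by
    have := (hℓ t (a t)).1 (by rw [h]; rfl)
    exact this.1 rfl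
  have hform0 : ∀ t, linForm (ℓ t) ≠ 0 := fun t h => hℓ0 t <| LinearMap.ext fun x => by
    rw [← eval_linForm, h]; simp
  refine ⟨∏ t, linForm (ℓ t), Finset.prod_ne_zero_iff.2 fun t _ => hform0 t, ?_, fun i => ?_, ?_⟩
  · simpa using IsHomogeneous.prod Finset.univ (fun t => linForm (ℓ t)) (fun _ => 1)
      fun t _ => isHomogeneous_linForm (ℓ t)
  · rw [orderAt_prod]
    have h1 : ∀ t ∈ Finset.univ, ((if a t = i ∨ b t = i then 0 else 1 : ℕ) : ℕ∞) ≤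
        orderAt (linForm (ℓ t)) (v i) := fun t _ => by
      split_ifs with h
      · simp
      · push Not at h
        simpa using one_le_orderAt_linForm ((hℓ t i).2 ⟨h.1.symm, h.2.symm⟩)
    refine le_trans ?_ (Finset.sum_le_sum h1)
    rw [← Nat.cast_sum, Nat.cast_le]
    have h2 := Finset.card_filter_add_card_filter_not (s := (Finset.univ : Finset (Fin d)))
      (fun t => a t = i ∨ b t = i)
    have h3 := hdeg i
    have h4 := hm i
    rw [Finset.sum_ite, Finset.sum_const_zero, zero_add, Finset.sum_const, smul_eq_mul, mul_one]
    simp only [Finset.card_univ, Fintype.card_fin] at h2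
    omega
  · obtain ⟨i₀, hi₀⟩ := hI
    have hne : v i₀ ≠ 0 := by
      have := hv {i₀} (by simp)
      rw [Finset.coe_singleton, linearIndepOn_singleton_iff] at this
      exact this
    obtain ⟨ℓ₀, hℓ₀⟩ := Module.exists_dual_forall_apply_ne_zero (K := ℂ) (fun _ : Unit => v i₀)
      fun _ => hne
    -- A general `w` in the span avoids all hyperplanes not containing it; the extra functional `ℓ₀`
    -- ensures `w ≠ 0`.
    let F : Option {t : Fin d // a t ∈ I ∨ b t ∈ I} → Module.Dual ℂ (Fin (n + 1) → ℂ) :=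
      fun o => o.elim ℓ₀ fun t => ℓ t
    obtain ⟨w, hw, hF⟩ := Module.Dual.exists_forall_mem_ne_zero_of_forall_exists
      (Submodule.span ℂ (v '' I)) F (by
        rintro (_ | ⟨t, ht | ht⟩)
        · exact ⟨v i₀, Submodule.subset_span ⟨i₀, hi₀, rfl⟩, hℓ₀ ()⟩
        · exact ⟨v (a t), Submodule.subset_span ⟨_, ht, rfl⟩, fun h => ((hℓ t _).1 h).1 rfl⟩
        · exact ⟨v (b t), Submodule.subset_span ⟨_, ht, rfl⟩, fun h => ((hℓ t _).1 h).2 rfl⟩)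
    refine ⟨w, hw, ?_, fun x hx => ?_⟩
    · rintro rfl
      exact hF none (map_zero _)
    · rw [orderAt_prod]
      have h1 : ∀ t ∈ Finset.univ, orderAt (linForm (ℓ t)) (x • w) ≤
          ((if a t ∉ I ∧ b t ∉ I then 1 else 0 : ℕ) : ℕ∞) := fun t _ => by
        split_ifs with h
        · simpa using orderAt_linForm_le_one (hℓ0 t) (x • w)
        · have ht : a t ∈ I ∨ b t ∈ I := by tauto
          rw [orderAt_linForm_eq_zero]
          · simp
          · rw [map_smul, smul_eq_mul]
            exact mul_ne_zero hx (hF (some ⟨t, ht⟩))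
      refine (Finset.sum_le_sum h1).trans ?_
      rw [← Nat.cast_sum, Nat.cast_le, ← Finset.card_filter]
      exact hout

/-! ### Adding general points, and passage to projective space. -/

/-- The spans of at most `n` of the vectors are finitely many proper subspaces, which cannot cover
the space over an infinite field. -/
theorem GeneralVectors.exists_snoc {n N : ℕ} {v : Fin N → Fin (n + 1) → ℂ}
    (hv : GeneralVectors v) : ∃ v' : Fin (N + 1) → Fin (n + 1) → ℂ,
      GeneralVectors v' ∧ ∀ i : Fin N, v' i.castSucc = v i := by
  classical
  obtain ⟨x, hx⟩ := Submodule.exists_forall_notMem_of_forall_ne_top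
    (fun J : {J : Finset (Fin N) // J.card ≤ n} => Submodule.span ℂ (v '' (J : Set (Fin N))))
    (fun J h => by
      have h1 : Module.finrank ℂ (Submodule.span ℂ (v '' (J.1 : Set (Fin N)))) ≤ n := by
        rw [← Finset.coe_image]
        exact (finrank_span_finset_le_card _).trans (Finset.card_image_le.trans J.2)
      rw [h, finrank_top] at h1
      simp at h1)
  let v' : Fin (N + 1) → Fin (n + 1) → ℂ := Fin.snoc v x
  have hcast : ∀ i : Fin N, v' i.castSucc = v i := fun i => by simp [v']
  have hlast : v' (Fin.last N) = x := by simp [v']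
  refine ⟨v', fun I hI => ?_, hcast⟩
  let J : Finset (Fin N) := Finset.univ.filter fun i => i.castSucc ∈ I
  have hJ : (I.erase (Fin.last N) : Finset (Fin (N + 1))) = J.map Fin.castSuccEmb := by
    ext i
    induction i using Fin.lastCases with
    | last => simp [J, Fin.castSucc_ne_last]
    | cast i => simp [J, Fin.castSucc_ne_last]
  have hJindep : J.card ≤ n + 1 → LinearIndepOn ℂ v' (Fin.castSucc '' (J : Set (Fin N))) :=
    fun hc => LinearIndepOn.image_of_comp _ _ <| by
      rw [show v' ∘ Fin.castSucc = v from funext hcast]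
      exact hv J hc
  by_cases hl : Fin.last N ∈ I
  · have hcard : J.card ≤ n := by
      have := Finset.card_erase_of_mem hl
      rw [hJ, Finset.card_map] at this
      omega
    have hIeq : (I : Set (Fin (N + 1))) =
        insert (Fin.last N) (Fin.castSucc '' (J : Set (Fin N))) := by
      rw [← Finset.insert_erase hl, hJ]
      simp
    rw [hIeq]
    refine (hJindep (by omega)).insert ?_
    rw [hlast, Set.image_image]
    simp only [hcast]
    exact hx ⟨J, hcard⟩
  · rw [Finset.erase_eq_of_notMem hl] at hJ
    have hIeq : (I : Set (Fin (N + 1))) = Fin.castSucc '' (J : Set (Fin N)) := by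
      rw [hJ]; simp
    rw [hIeq]
    refine hJindep ?_
    rwa [hJ, Finset.card_map] at hI

theorem GeneralVectors.exists_extend {n N M : ℕ} (hNM : N ≤ M) {v : Fin N → Fin (n + 1) → ℂ}
    (hv : GeneralVectors v) : ∃ v' : Fin M → Fin (n + 1) → ℂ,
      GeneralVectors v' ∧ ∀ i : Fin N, v' (Fin.castLE hNM i) = v i := by
  induction M, hNM using Nat.le_induction with
  | base => exact ⟨v, hv, fun i => rfl⟩
  | succ M hM ih =>
    obtain ⟨v', hv', h⟩ := ih
    obtain ⟨v'', hv'', h'⟩ := hv'.exists_snoc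
    exact ⟨v'', hv'', fun i => (h' _).trans (h i)⟩

theorem linearCycle_eq_projectivization {n s : ℕ} (p : Fin s → PSpace n) (I : Finset (Fin s)) :
    linearCycle p I = (Submodule.span ℂ ((fun i => (p i).rep) '' I)).projectivization := by
  apply le_antisymm
  · rw [linearCycle, Projectivization.Subspace.span_le_subspace_iff]
    rintro _ ⟨i, hi, rfl⟩
    rw [← (p i).mk_rep]
    exact (Submodule.mk_mem_projectivization_iff _ (p i).rep_nonzero).2
      (Submodule.subset_span ⟨i, hi, rfl⟩)
  · rw [← OrderIso.le_symm_apply, OrderIso.symm_symm, Submodule.span_le]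
    rintro _ ⟨i, hi, rfl⟩
    refine (Projectivization.Subspace.mem_submodule_iff _ (p i).rep_nonzero).2 ?_
    rw [Projectivization.mk_rep]
    exact Projectivization.Subspace.subset_span _ ⟨i, hi, rfl⟩

theorem mem_linearCycle_iff {n s : ℕ} {p : Fin s → PSpace n} {I : Finset (Fin s)} {x : PSpace n} :
    x ∈ linearCycle p I ↔ x.rep ∈ Submodule.span ℂ ((fun i => (p i).rep) '' I) := by
  rw [linearCycle_eq_projectivization]
  conv_lhs => rw [← x.mk_rep]
  exact Submodule.mk_mem_projectivization_iff _ x.rep_nonzero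

end LinSys

/-! ### The multiplicity of the base locus. -/

theorem proposition2p5 (n s d : ℕ) (hs : s ≤ n + 2)
    (p : Fin s → LinSys.PSpace n) (hp : LinSys.GeneralPosition p)
    (m : Fin s → ℕ) (hne : (LinSys.linearSystem d p m).Nonempty)
    (r : ℕ) (hr : r + 1 ≤ min n s) (I : Finset (Fin s)) (hI : I.card = r + 1) :
    LinSys.baseMult (LinSys.linearSystem d p m) (LinSys.linearCycle p I) =
      (LinSys.expMult d m r I : ℕ∞) := by
  classical
  have hgen : LinSys.GeneralVectors fun i => (p i).rep := fun J hJ =>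
    Projectivization.independent_iff.1 (hp J hJ)
  obtain ⟨v, hv, hvp⟩ := hgen.exists_extend hs
  let e : Fin s ↪ Fin (n + 2) := Fin.castLEEmb hs
  -- Multiplicity 0 at the added points leaves the linear system unchanged.
  let m' : Fin (n + 2) → ℕ := Function.extend e m 0
  have hm'e : ∀ i, m' (e i) = m i := fun i => e.injective.extend_apply m 0 i
  have hmem : ∀ f, f ∈ LinSys.linearSystem d p m ↔
      f ≠ 0 ∧ f.IsHomogeneous d ∧ ∀ i, (m' i : ℕ∞) ≤ LinSys.orderAt f (v i) := fun f => by
    refine and_congr_right fun _ => and_congr_right fun _ => ⟨fun h i => ?_, fun h i => ?_⟩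
    · by_cases hi : ∃ i', e i' = i
      · obtain ⟨i, rfl⟩ := hi
        rw [hm'e, show v (e i) = _ from hvp i]
        exact h i
      · simp [m', Function.extend_apply' _ _ _ hi]
    · have := h (e i)
      rwa [hm'e, show v (e i) = _ from hvp i] at this
  have hcyc : ∀ x : LinSys.PSpace n, x ∈ LinSys.linearCycle p I ↔
      x.rep ∈ Submodule.span ℂ (v '' (I.map e : Finset (Fin (n + 2)))) := fun x => by
    rw [LinSys.mem_linearCycle_iff, Finset.coe_map, Set.image_image]
    simp only [show ∀ i, v (e i) = (p i).rep from hvp]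
  have hsumI : ∑ i ∈ I.map e, m' i = ∑ i ∈ I, m i := by simp [hm'e]
  obtain ⟨f₀, hf₀⟩ := hne
  rw [hmem] at hf₀
  obtain ⟨hle, hsum⟩ := hv.numerical_bounds hf₀.1 hf₀.2.1 hf₀.2.2
  have hcast : (∑ i ∈ I, (m i : ℤ)) - (r : ℤ) * (d : ℤ) =
      ((∑ i ∈ I, m i : ℕ) : ℤ) - ((r * d : ℕ) : ℤ) := by push_cast; ring
  apply le_antisymm
  · obtain ⟨f, hf0, hf, hfm, w, hw, hw0, hord⟩ := hv.exists_form hle hsum (I := I.map e)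
      (Finset.card_pos.1 (by rw [Finset.card_map]; omega))
    -- The chosen representative of the point is only some multiple of `w`.
    obtain ⟨x, hx⟩ := Projectivization.exists_smul_eq_mk_rep ℂ w hw0
    have hxmem : Projectivization.mk ℂ w hw0 ∈ LinSys.linearCycle p I := by
      rw [hcyc, ← hx]
      exact Submodule.smul_mem _ _ hw
    refine (iInf₂_le f ((hmem f).2 ⟨hf0, hf, hfm⟩)).trans ((iInf₂_le _ hxmem).trans ?_)
    rw [LinSys.multAt, ← hx]
    refine (hord x x.ne_zero).trans (Nat.cast_le.2 ?_)
    have h1 : ∑ i ∈ I.map e, (d - m' i) + ∑ i ∈ I, m i = (r + 1) * d := by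
      rw [← hsumI, ← Finset.sum_add_distrib,
        Finset.sum_congr rfl fun i _ => Nat.sub_add_cancel (hle i)]
      simp [hI]
    rw [add_mul, one_mul] at h1
    rw [LinSys.expMult, hcast]
    omega
  · refine le_iInf₂ fun f hf => le_iInf₂ fun x hx => ?_
    rw [hmem] at hf
    -- If `k_I` is truncated to 0, `k_I + r * d ≤ ∑ i ∈ I, m i` may fail, but the bound is trivial.
    rcases Nat.eq_zero_or_pos (LinSys.expMult d m r I) with h0 | hpos
    · rw [h0]
      simp
    · refine hv.natCast_le_orderAt_of_mem_span hf.2.1 hf.2.2 (r := r) (I := I.map e)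
        (by rw [Finset.card_map, hI]) (by omega) ?_ ((hcyc x).1 hx)
      rw [hsumI]
      rw [LinSys.expMult, hcast] at hpos ⊢
      omega
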